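/- **Theorem (Graham–Rothschild).** Let $\Sigma$ be a finite alphabet and fix pairwise distinct symbols $\lambda_0,\lambda_1,\dots$ (the parameters) that do not belong to $\Sigma$. For natural numbers $k,n$ and $\Pi\subseteq\Sigma$, a *$k$-parameter word of length $n$ in the alphabet $\Pi$* is a word $W=W_0W_1\cdots W_{n-1}$ over $\Pi\cup\{\lambda_0,\dots,\lambda_{k-1}\}$ in which every $\lambda_i$ with $0\le i<k$ occurs and, for every $0<i<k$, the first occurrence of $\lambda_i$ comes after the first occurrence of $\lambda_{i-1}$. If $W$ is an $m$-parameter word of length $N$ in the alphabet $\Sigma$ and $U=U_0\cdots U_{m-1}$ is a $k$-parameter word of length $m$ in the alphabet $\Sigma$, then $W(U)$ denotes the $k$-parameter word of length $N$ in the alphabet $\Sigma$ obtained from $W$ by replacing every occurrence of $\lambda_i$ by $U_i$, for each $0\le i<m$. For every pair of finite alphabets $\Pi\subseteq\Sigma$ (either may be empty) and all natural numbers $k,m,r$ with $0<k<m$ and $r>0$, there is a positive integer $N$ such that for every $r$-colouring of the $k$-parameter words of length $N$ in the alphabet $\Sigma$ there exists an $m$-parameter word $W$ of length $N$ in the alphabet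 $\Pi$ such that the set $$\{W(U) : U \text{ is a } k\text{-parameter word of length } m \text{ in the alphabet } \Pi\}$$ is monochromatic. (For $\Pi=\Sigma$ this is the usual Graham–Rothschild theorem over one alphabet.) -/

import Mathlib

/-- A `k`-parameter word of length `n` in the alphabet `A` (with `k` and `n` finite): a word over
`A ∪ {λ_0, …, λ_{k-1}}`, where `Sum.inl a` is the letter `a` and `Sum.inr i` is the parameter
`λ_i`.  Every parameter occurs, and the first occurrence of `λ_{i+1}` comes after the first
occurrence of `λ_i` (that is, every occurrence of `λ_{i+1}` is preceded by one of `λ_i`). -/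
structure ParamWord (A : Type*) (k n : ℕ) where
  letter : Fin n → A ⊕ Fin k
  occurs : ∀ i : Fin k, ∃ p : Fin n, letter p = Sum.inr i
  ordered : ∀ i j : Fin k, (i : ℕ) + 1 = (j : ℕ) →
    ∀ q : Fin n, letter q = Sum.inr j → ∃ p : Fin n, p < q ∧ letter p = Sum.inr i

namespace ParamWord

variable {A : Type*} {k m n : ℕ}

/-- All letters of the word that are not parameters belong to the alphabet `P`. -/
def InAlphabet (W : ParamWord A k n) (P : Set A) : Prop :=
  ∀ (p : Fin n) (a : A), W.letter p = Sum.inl a → a ∈ P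

theorem exists_before (W : ParamWord A k n) (d : ℕ) :
    ∀ (i j : Fin k), (i : ℕ) + (d + 1) = (j : ℕ) →
      ∀ q : Fin n, W.letter q = Sum.inr j → ∃ p : Fin n, p < q ∧ W.letter p = Sum.inr i := by
  induction d with
  | zero => exact fun i j h => W.ordered i j h
  | succ d ih =>
    intro i j h q hq
    have hj := j.isLt
    obtain ⟨p, hp, hpl⟩ := W.ordered ⟨i + (d + 1), by omega⟩ j (by simp; omega) q hq
    obtain ⟨p', hp', hpl'⟩ := ih i ⟨i + (d + 1), by omega⟩ rfl p hpl
    exact ⟨p', hp'.trans hp, hpl'⟩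

/-- The substitution `W(U)`: every occurrence of `λ_i` in the `m`-parameter word `W` is replaced
by the `i`-th symbol of `U`.  As `U` has length `m`, no truncation takes place. -/
def subst (W : ParamWord A m n) (U : ParamWord A k m) : ParamWord A k n where
  letter p := Sum.elim Sum.inl U.letter (W.letter p)
  occurs i := by
    obtain ⟨s, hs⟩ := U.occurs i
    obtain ⟨p, hp⟩ := W.occurs s
    exact ⟨p, by simp [hp, hs]⟩
  ordered i j hij q hq := by
    cases hW : W.letter q with
    | inl a => simp [hW] at hq
    | inr s =>
      simp only [hW, Sum.elim_inr] at hq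
      obtain ⟨t, hts, ht⟩ := U.ordered i j hij s hq
      have hts' : (t : ℕ) < (s : ℕ) := hts
      obtain ⟨p, hp, hpl⟩ := W.exists_before ((s : ℕ) - t - 1) t s (by omega) q hW
      exact ⟨p, hp, by simp [hpl, ht]⟩

end ParamWord

/-!
Code the letters by `0, …, a - 1` and the parameter `λ_i` by `a + i`. A `(d + 1)`-parameter word is
then a word over `a` letters (its initial segment) followed by a `d`-parameter word over `a + 1`
letters, because from its first occurrence on `a` behaves like a letter. This allows an induction on
the number of parameters, for all alphabets at once. The case of `d` parameters, applied at every
possible length of the initial segment, yields a `W` such that the colour of `W(U)` depends only on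
the initial segment of `U`. The Hales–Jewett theorem makes the colour of an initial segment depend
only on its length, and a pigeonhole choice of lengths makes it constant. Without parameters the
initial segment is the whole word, of known length.
-/

/-- A parameter word coded as a list: the numbers below `a` are the letters, `a + i` is the
parameter `λ_i`.  `Growth a b w` says that, reading `w` when `0, …, a - 1` are already available,
every entry is either available or the least unavailable number, and that `0, …, b - 1` are
available at the end; so `w` has `b - a` parameters. -/
inductive Growth : ℕ → ℕ → List ℕ → Prop
  | nil (a : ℕ) : Growth a a []
  | old {a b i : ℕ} {w : List ℕ} : i < a → Growth a b w → Growth a b (i :: w)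
  | new {a b : ℕ} {w : List ℕ} : Growth (a + 1) b w → Growth a b (a :: w)

/-- The symbol that replaces `i` when the parameters `a, a + 1, …` are replaced by the successive
entries of `U`; thus `W.map (fill a U)` is the substitution `W(U)`.  Parameters beyond the length
of `U` get the junk value `0`. -/
def fill (a : ℕ) (U : List ℕ) (i : ℕ) : ℕ := if i < a then i else U.getD (i - a) 0

/-- The symbol that replaces `i` when every parameter `a, a + 1, …` is renamed to the next one,
which frees `a` for a further parameter at the front. -/
def skip (a i : ℕ) : ℕ := if i < a then i else i + 1

/-- The letters of `w` before its first parameter. -/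
def initial (a : ℕ) (w : List ℕ) : List ℕ := w.takeWhile (· < a)

section Substitution

variable {a i : ℕ} {U : List ℕ}

theorem fill_of_lt (U : List ℕ) (h : i < a) : fill a U i = i := if_pos h

theorem fill_add (a i : ℕ) (U : List ℕ) : fill a U (a + i) = U.getD i 0 := by simp [fill]

theorem fill_self_cons (a : ℕ) (U : List ℕ) : fill a (a :: U) = fill (a + 1) U := by
  funext i
  rcases lt_or_ge i a with h | h
  · rw [fill_of_lt _ h, fill_of_lt _ (by omega)]
  · obtain ⟨_ | j, rfl⟩ := Nat.exists_eq_add_of_le h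
    · simp [fill]
    · rw [fill_add, List.getD_cons_succ, ← fill_add (a + 1), Nat.add_right_comm, Nat.add_assoc]

theorem fill_cons_skip (a x i : ℕ) (U : List ℕ) : fill a (x :: U) (skip a i) = fill a U i := by
  rcases lt_or_ge i a with h | h
  · rw [skip, if_pos h, fill_of_lt _ h, fill_of_lt _ h]
  · obtain ⟨j, rfl⟩ := Nat.exists_eq_add_of_le h
    rw [skip, if_neg (by omega), Nat.add_assoc, fill_add, fill_add, List.getD_cons_succ]

theorem map_fill_cons_map_skip (a x : ℕ) (U W : List ℕ) :
    (W.map (skip a)).map (fill a (x :: U)) = W.map (fill a U) := by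
  simp only [List.map_map, Function.comp_def, fill_cons_skip]

theorem map_fill_self_cons_map_skip (a x : ℕ) (U W : List ℕ) :
    (a :: W.map (skip a)).map (fill a (x :: U)) = x :: W.map (fill a U) := by
  rw [List.map_cons, map_fill_cons_map_skip]
  simp [fill]

theorem map_fill_self_cons (a : ℕ) (U W : List ℕ) :
    (a :: W).map (fill a (a :: U)) = a :: W.map (fill (a + 1) U) := by
  rw [fill_self_cons, List.map_cons, fill_of_lt _ a.lt_succ_self]

theorem fill_append_of_lt (U V : List ℕ) (h : i < a + U.length) :
    fill a (U ++ V) i = fill a U i := by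
  unfold fill
  split_ifs
  · rfl
  · exact List.getD_append _ _ _ _ (by omega)

theorem fill_fill (V : List ℕ) (h : i < a + U.length) :
    fill a V (fill a U i) = fill a (U.map (fill a V)) i := by
  rcases lt_or_ge i a with h' | h'
  · simp only [fill_of_lt _ h']
  · obtain ⟨j, rfl⟩ := Nat.exists_eq_add_of_le h'
    simp [fill_add, show j < U.length by omega]

theorem map_fill_range' (a : ℕ) (U : List ℕ) : (List.range' a U.length).map (fill a U) = U :=
  List.ext_getElem (by simp) fun i h _ => by
    simp only [List.length_map, List.length_range'] at h
    simp [fill_add, h]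

end Substitution

namespace Growth

variable {a b c i j m q x : ℕ} {u v w U W : List ℕ}

theorem le (h : Growth a b w) : a ≤ b := by
  induction h with
  | nil => rfl
  | old _ _ ih => exact ih
  | new _ ih => omega

theorem lt (h : Growth a b w) : ∀ i ∈ w, i < b := by
  induction h with
  | nil => simp
  | old hi h ih => simpa using ⟨hi.trans_le h.le, ih⟩
  | new h ih => simpa using ⟨h.le, ih⟩

theorem of_lt (h : ∀ i ∈ w, i < a) : Growth a a w := by
  induction w with
  | nil => exact .nil a
  | cons x w ih => exact .old (h x (by simp)) (ih fun i hi => h i (by simp [hi]))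

theorem of_forall_le_of_mem (h : ∀ i ∈ w, i ≤ a) (ha : a ∈ w) : Growth a (a + 1) w := by
  induction w with
  | nil => simp at ha
  | cons x w ih =>
    have hw : ∀ i ∈ w, i ≤ a := fun i hi => h i (by simp [hi])
    rcases (h x (by simp)).lt_or_eq with hx | rfl
    · exact .old hx (ih hw ((List.mem_cons.1 ha).resolve_left (by omega)))
    · exact .new (.of_lt fun i hi => Nat.lt_succ_of_le (hw i hi))

theorem append (h : Growth a b u) (h' : Growth b c v) : Growth a c (u ++ v) := by
  induction h with
  | nil => exact h'
  | old hi _ ih => exact .old hi (ih h')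
  | new _ ih => exact .new (ih h')

theorem cons_cases (h : Growth a b (x :: w)) :
    x < a ∧ Growth a b w ∨ x = a ∧ Growth (a + 1) b w := by
  rcases h with _ | ⟨hx, h⟩ | h
  · exact .inl ⟨hx, h⟩
  · exact .inr ⟨rfl, h⟩

theorem mem (h : Growth a b w) (hai : a ≤ i) (hib : i < b) : i ∈ w := by
  induction h with
  | nil => omega
  | old _ _ ih => exact List.mem_cons_of_mem _ (ih hai hib)
  | new _ ih =>
    rcases hai.eq_or_lt with rfl | hai
    · exact List.mem_cons_self
    · exact List.mem_cons_of_mem _ (ih hai hib)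

theorem exists_lt_getElem?_eq (h : Growth a b w) (hai : a ≤ i) (hq : w[q]? = some (i + 1)) :
    ∃ p < q, w[p]? = some i := by
  induction h generalizing q with
  | nil => simp at hq
  | old hx _ ih =>
    cases q with
    | zero =>
      rw [List.getElem?_cons_zero, Option.some_inj] at hq
      omega
    | succ q =>
      obtain ⟨p, hp, hpi⟩ := ih hai hq
      exact ⟨p + 1, by omega, hpi⟩
  | new _ ih =>
    cases q with
    | zero =>
      rw [List.getElem?_cons_zero, Option.some_inj] at hq
      omega
    | succ q =>
      rcases hai.eq_or_lt with rfl | hai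
      · exact ⟨0, q.succ_pos, rfl⟩
      · obtain ⟨p, hp, hpi⟩ := ih hai hq
        exact ⟨p + 1, by omega, hpi⟩

theorem of_forall (hab : a ≤ b) (hlt : ∀ i ∈ w, i < b) (hmem : ∀ i, a ≤ i → i < b → i ∈ w)
    (hord : ∀ i q : ℕ, a ≤ i → w[q]? = some (i + 1) → ∃ p < q, w[p]? = some i) : Growth a b w := by
  induction w generalizing a with
  | nil =>
    rcases hab.eq_or_lt with rfl | hab
    · exact .nil a
    · simpa using hmem a le_rfl hab
  | cons x w ih =>
    have hxb : x < b := hlt x (by simp)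
    have hxa : x ≤ a := by
      by_contra! hax
      obtain ⟨p, hp, -⟩ := hord (x - 1) 0 (by omega) (by simp; omega)
      exact absurd hp (by omega)
    have growth_tail {c : ℕ} (hac : a ≤ c) (hxc : x < c) (hcb : c ≤ b) : Growth c b w := by
      refine ih hcb (fun i hi => hlt i (by simp [hi])) (fun i hci hib => ?_) fun i q hci hq => ?_
      · exact (List.mem_cons.1 (hmem i (by omega) hib)).resolve_left (by omega)
      · obtain ⟨_ | p, hp, hpi⟩ := hord i (q + 1) (by omega) hq
        · rw [List.getElem?_cons_zero, Option.some_inj] at hpi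
          omega
        · exact ⟨p, by omega, hpi⟩
    rcases hxa.lt_or_eq with hxa | rfl
    · exact .old hxa (growth_tail le_rfl hxa hab)
    · exact .new (growth_tail (by omega) (by omega) hxb)

theorem map {g : ℕ → ℕ} (hW : Growth j (j + m) W) (hlt : ∀ i < j, g i < a)
    (hg : Growth a b ((List.range' j m).map g)) : Growth a b (W.map g) := by
  generalize hn : j + m = n at hW
  induction hW generalizing a m with
  | nil =>
    obtain rfl : m = 0 := by omega
    exact hg
  | old hi _ ih => exact .old (hlt _ hi) (ih hlt hg hn)
  | @new j n W hW ih =>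
    obtain ⟨m, rfl⟩ : ∃ l, m = l + 1 := ⟨m - 1, by have := hW.le; omega⟩
    rw [List.range'_succ, List.map_cons] at hg
    rw [List.map_cons]
    rcases hg.cons_cases with ⟨hj, hg⟩ | ⟨hj, hg⟩
    · refine .old hj (ih (fun i hi => ?_) hg (by omega))
      rcases Nat.lt_succ_iff_lt_or_eq.1 hi with hi | rfl
      exacts [hlt i hi, hj]
    · rw [hj]
      refine .new (ih (fun i hi => ?_) hg (by omega))
      rcases Nat.lt_succ_iff_lt_or_eq.1 hi with hi | rfl
      exacts [(hlt i hi).trans a.lt_succ_self, hj ▸ a.lt_succ_self]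

theorem map_fill (hW : Growth a (a + m) W) (hU : Growth a b U) (hm : U.length = m) :
    Growth a b (W.map (fill a U)) := by
  subst hm
  refine hW.map (fun i hi => ?_) (by rwa [map_fill_range'])
  rwa [fill_of_lt U hi]

theorem map_fill_map_fill (hW : Growth a (a + m) W) (hm : U.length = m) (V : List ℕ) :
    (W.map (fill a U)).map (fill a V) = W.map (fill a (U.map (fill a V))) := by
  rw [List.map_map]
  exact List.map_congr_left fun i hi => fill_fill _ (hm ▸ hW.lt i hi)

theorem map_fill_append (hW : Growth a (a + m) W) (hm : U.length = m) (V : List ℕ) :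
    W.map (fill a (U ++ V)) = W.map (fill a U) :=
  List.map_congr_left fun i hi => fill_append_of_lt _ _ (hm ▸ hW.lt i hi)

theorem map_skip_of_le (hW : Growth c b W) (hac : a ≤ c) :
    Growth (c + 1) (b + 1) (W.map (skip a)) := by
  induction hW with
  | nil => exact .nil _
  | old hi _ ih =>
    refine .old ?_ (ih hac)
    rw [skip]
    split_ifs <;> omega
  | new _ ih =>
    rw [List.map_cons, skip, if_neg (by omega)]
    exact .new (ih (by omega))

theorem map_skip (hW : Growth a b W) : Growth (a + 1) (b + 1) (W.map (skip a)) :=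
  hW.map_skip_of_le le_rfl

end Growth

section Initial

variable {a b x : ℕ} {u w : List ℕ}

theorem lt_of_mem_initial {i : ℕ} (h : i ∈ initial a w) : i < a := by
  simpa using List.mem_takeWhile_imp h

theorem initial_append_of_lt (hu : ∀ i ∈ u, i < a) (w : List ℕ) :
    initial a (u ++ w) = u ++ initial a w :=
  List.takeWhile_append_of_pos (by simpa using hu)

theorem initial_eq_self (hw : ∀ i ∈ w, i < a) : initial a w = w :=
  List.takeWhile_eq_self_iff.2 (by simpa using hw)

theorem initial_cons_of_lt (hx : x < a) (w : List ℕ) : initial a (x :: w) = x :: initial a w :=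
  List.takeWhile_cons_of_pos (by simpa using hx)

theorem initial_cons_self (a : ℕ) (w : List ℕ) : initial a (a :: w) = [] :=
  List.takeWhile_cons_of_neg (by simp)

theorem length_initial_le (a : ℕ) (w : List ℕ) : (initial a w).length ≤ w.length :=
  (List.takeWhile_sublist _).length_le

theorem Growth.initial_append (hu : Growth a b u) (hab : a < b) (w : List ℕ) :
    initial a (u ++ w) = initial a u := by
  induction hu with
  | nil => omega
  | old hi _ ih => rw [List.cons_append, initial_cons_of_lt hi, initial_cons_of_lt hi, ih hab]
  | new => rw [List.cons_append, initial_cons_self, initial_cons_self]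

end Initial

/-- The Graham–Rothschild property for growth words: every finite colouring admits, at some
length depending only on the colours, a word with `m` parameters over `a` letters all of whose
substitution instances with `d` parameters have one colour.  Colourings are defined on all lists,
which avoids a dependent type of words. -/
def GrahamRothschild.{u} (a m d : ℕ) : Prop :=
  ∀ (κ : Type u) [Finite κ], ∃ N : ℕ, ∀ c : List ℕ → κ, ∃ W : List ℕ, W.length = N ∧
    Growth a (a + m) W ∧
      ∃ γ : κ, ∀ U, Growth a (a + d) U → U.length = m → c (W.map (fill a U)) = γ

theorem exists_length_initial_of_le_count {a : ℕ} (ha : 0 < a) (p : ℕ → Prop) [DecidablePred p]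
    (n : ℕ) {m : ℕ} (hm : m ≤ n.count p) :
    ∃ V : List ℕ, V.length = n ∧ Growth a (a + m) V ∧
      ∀ U b, Growth a b U → a < b → U.length = m → p (initial a (V.map (fill a U))).length := by
  -- `V` has its parameters at positions satisfying `p` and the letter `0` everywhere else.
  induction n generalizing p m with
  | zero =>
    obtain rfl : m = 0 := by simpa using hm
    refine ⟨[], rfl, .nil a, fun U b hU hab hU0 => ?_⟩
    obtain rfl := List.length_eq_zero_iff.1 hU0
    cases hU
    exact absurd hab (lt_irrefl a)
  | succ n ih =>
    rw [Nat.count_succ'] at hm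
    by_cases h : p 0 ∧ ∃ l, m = l + 1
    · obtain ⟨hp, m, rfl⟩ := h
      obtain ⟨V, hVn, hV, hVp⟩ := ih (fun q => p (q + 1)) (m := m) (by simpa [hp] using hm)
      refine ⟨a :: V.map (skip a), by simp [hVn], .new hV.map_skip, fun U b hU hab hUm => ?_⟩
      obtain ⟨x, U, rfl⟩ := List.exists_cons_of_length_eq_add_one hUm
      rw [map_fill_self_cons_map_skip]
      rcases hU.cons_cases with ⟨hx, hU⟩ | ⟨rfl, -⟩
      · rw [initial_cons_of_lt hx]
        exact hVp U b hU hab (by simpa using hUm)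
      · rwa [initial_cons_self]
    · have hm' : m ≤ n.count fun q => p (q + 1) := by
        rcases m with _ | m
        · exact Nat.zero_le _
        · simpa [show ¬ p 0 from fun hp => h ⟨hp, m, rfl⟩] using hm
      obtain ⟨V, hVn, hV, hVp⟩ := ih (fun q => p (q + 1)) hm'
      refine ⟨0 :: V, by simp [hVn], .old ha hV, fun U b hU hab hUm => ?_⟩
      rw [List.map_cons, fill_of_lt _ ha, initial_cons_of_lt ha]
      exact hVp U b hU hab hUm

theorem exists_le_count_eq {κ : Type*} [Finite κ] [DecidableEq κ] (m : ℕ) (f : ℕ → κ) :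
    ∃ γ : κ, m ≤ (Nat.card κ * m).count (f · = γ) := by
  have := Fintype.ofFinite κ
  obtain ⟨γ, -, hγ⟩ := Finset.exists_le_card_fiber_of_mul_le_card_of_maps_to
    (s := Finset.range (Nat.card κ * m)) (f := f) (n := m)
    (fun _ _ => Finset.mem_univ _) ⟨f 0, Finset.mem_univ _⟩ (by simp [Finset.card_univ])
  exact ⟨γ, by rwa [Nat.count_eq_card_filter_range]⟩

section Coloring

variable (a m : ℕ) (κ : Type*) [Finite κ]

theorem exists_color_map_fill_singleton_eq :
    ∃ N : ℕ, ∀ c : List ℕ → κ, ∃ B : List ℕ, B.length = N ∧ Growth a (a + 1) B ∧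
      ∃ γ : κ, ∀ x < a, c (B.map (fill a [x])) = γ := by
  obtain ⟨ι, _, hι⟩ := Combinatorics.Line.exists_mono_in_high_dimension (Fin a) κ
  let L : List ι := Finset.univ.toList
  refine ⟨L.length, fun c => ?_⟩
  obtain ⟨l, γ, hl⟩ := hι fun f => c (L.map fun j => f j)
  refine ⟨L.map fun j => (l.idxFun j).elim a (↑), by simp, .of_forall_le_of_mem ?_ ?_, γ,
    fun x hx => ?_⟩
  · simp only [List.forall_mem_map]
    intro j _
    cases l.idxFun j with
    | none => exact le_rfl
    | some y => exact y.is_lt.le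
  · obtain ⟨j, hj⟩ := l.proper
    exact List.mem_map.2 ⟨j, by simp [L], by rw [hj]; rfl⟩
  · rw [← hl ⟨x, hx⟩, List.map_map]
    congr 1
    refine List.map_congr_left fun j _ => ?_
    rw [Function.comp_apply, Combinatorics.Line.apply_def]
    cases hj : l.idxFun j with
    | none => simp [hj, fill]
    | some y => simpa [hj] using fill_of_lt [x] y.is_lt

theorem exists_color_map_fill_singleton_append_eq (n : ℕ) :
    ∃ N : ℕ, ∀ c : List ℕ → κ, ∃ B : List ℕ, B.length = N ∧ Growth a (a + 1) B ∧
      ∃ γ : List ℕ → κ, ∀ x < a, ∀ T : List ℕ, (∀ i ∈ T, i < a) → T.length ≤ n →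
        c (B.map (fill a [x]) ++ T) = γ T := by
  have := (List.finite_length_le (Fin a) n).to_subtype
  obtain ⟨N, hN⟩ :=
    exists_color_map_fill_singleton_eq a ({T : List (Fin a) | T.length ≤ n} → κ)
  refine ⟨N, fun c => ?_⟩
  -- Colour `B` by all the colours `c (B ++ T)` at once.
  obtain ⟨B, hBN, hB, γ, hγ⟩ := hN fun B T => c (B ++ T.1.map (↑))
  refine ⟨B, hBN, hB, fun T => c (B.map (fill a [0]) ++ T), fun x hx T hT hTn => ?_⟩
  lift T to List (Fin a) using hT
  have hT : T ∈ {T : List (Fin a) | T.length ≤ n} := by simpa using hTn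
  exact congrFun ((hγ x hx).trans (hγ 0 (by omega)).symm) ⟨T, hT⟩

theorem exists_color_initial_eq_length :
    ∃ N : ℕ, ∀ c : List ℕ → κ, ∃ W : List ℕ, W.length = N ∧ Growth a (a + m) W ∧
      ∃ f : ℕ → κ, ∀ U b, Growth a b U → U.length = m →
        c (initial a (W.map (fill a U))) = f (initial a U).length := by
  induction m with
  | zero => exact ⟨0, fun c => ⟨[], rfl, .nil a, fun _ => c [], fun _ _ _ _ => rfl⟩⟩
  | succ m ih =>
    obtain ⟨N, hN⟩ := ih
    obtain ⟨L, hL⟩ := exists_color_map_fill_singleton_append_eq a κ N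
    refine ⟨L + N, fun c => ?_⟩
    obtain ⟨B, hBL, hB, γ, hγ⟩ := hL c
    obtain ⟨V, hVN, hV, f, hf⟩ := hN γ
    refine ⟨B ++ V.map (skip a), by simp [hBL, hVN], hB.append hV.map_skip,
      fun n => n.casesOn (c (initial a B)) f, fun U b hU hUm => ?_⟩
    obtain ⟨x, U, rfl⟩ := List.exists_cons_of_length_eq_add_one hUm
    have hW : (B ++ V.map (skip a)).map (fill a (x :: U)) =
        B.map (fill a [x]) ++ V.map (fill a U) := by
      rw [List.map_append, map_fill_cons_map_skip, ← hB.map_fill_append (U := [x]) rfl U]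
      rfl
    rw [hW]
    rcases hU.cons_cases with ⟨hx, hU⟩ | ⟨rfl, -⟩
    · have hBx : Growth a a (B.map (fill a [x])) := hB.map_fill (.old hx (.nil a)) rfl
      rw [initial_append_of_lt hBx.lt, initial_cons_of_lt hx,
        hγ x hx _ (fun i => lt_of_mem_initial) ((length_initial_le _ _).trans (by simp [hVN])),
        hf U b hU (by simpa using hUm)]
      rfl
    · have hBx : B.map (fill x [x]) = B := by
        conv_rhs => rw [← List.map_id B]
        refine List.map_congr_left fun i hi => ?_
        rw [fill_self_cons, fill_of_lt _ (hB.lt i hi), id]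
      rw [hBx, hB.initial_append (by omega), initial_cons_self]
      rfl

theorem exists_color_initial_eq :
    ∃ N : ℕ, ∀ c : List ℕ → κ, ∃ W : List ℕ, W.length = N ∧ Growth a (a + m) W ∧
      ∃ γ : κ, ∀ U b, Growth a b U → a < b → U.length = m →
        c (initial a (W.map (fill a U))) = γ := by
  classical
  rcases a.eq_zero_or_pos with rfl | ha
  · obtain ⟨N, hN⟩ := exists_color_initial_eq_length 0 m κ
    refine ⟨N, fun c => ?_⟩
    obtain ⟨W, hWN, hW, f, hf⟩ := hN c
    refine ⟨W, hWN, hW, f 0, fun U b hU _ hUm => ?_⟩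
    have initial_zero : initial 0 U = [] :=
      List.eq_nil_iff_forall_not_mem.2 fun i hi => i.not_lt_zero (lt_of_mem_initial hi)
    rw [hf U b hU hUm, initial_zero, List.length_nil]
  · obtain ⟨N, hN⟩ := exists_color_initial_eq_length a (Nat.card κ * m) κ
    refine ⟨N, fun c => ?_⟩
    obtain ⟨W, hWN, hW, f, hf⟩ := hN c
    obtain ⟨γ, hγ⟩ := exists_le_count_eq m f
    obtain ⟨V, hVM, hV, hVγ⟩ := exists_length_initial_of_le_count ha (f · = γ) _ hγ
    refine ⟨W.map (fill a V), by simpa using hWN, hW.map_fill hV hVM, γ, fun U b hU hab hUm => ?_⟩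
    rw [hW.map_fill_map_fill hVM, hf _ b (hV.map_fill hU hUm) (by simpa using hVM)]
    exact hVγ U b hU hab hUm

end Coloring

theorem exists_color_eq_initial.{u} {a d : ℕ} (h : ∀ m, GrahamRothschild.{u} (a + 1) m d) (m : ℕ)
    (κ : Type u) [Finite κ] :
    ∃ N : ℕ, ∀ c : List ℕ → κ, ∃ W : List ℕ, W.length = N ∧ Growth a (a + m) W ∧
      ∃ f : List ℕ → κ, ∀ U, Growth a (a + (d + 1)) U → U.length = m →
        c (W.map (fill a U)) = f (initial a U) := by
  induction m generalizing κ with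
  | zero => exact ⟨0, fun c => ⟨[], rfl, .nil a, fun _ => c [], fun _ _ _ => rfl⟩⟩
  | succ m ih =>
    obtain ⟨M, hM⟩ := ih (Fin a → κ)
    obtain ⟨N, hN⟩ := h M κ
    refine ⟨N + 1, fun c => ?_⟩
    obtain ⟨W, hWN, hW, γ, hγ⟩ := hN fun w => c (a :: w)
    obtain ⟨V, hVM, hV, f, hf⟩ := hM fun T x => c ((a :: W).map (fill a (x :: T)))
    have hW' : Growth a (a + (M + 1)) (a :: W) := .new (by rwa [Nat.add_right_comm] at hW)
    have hV' : (a :: V.map (skip a)).length = M + 1 := by simp [hVM]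
    refine ⟨(a :: W).map (fill a (a :: V.map (skip a))), by simp [hWN],
      hW'.map_fill (.new hV.map_skip) hV',
      fun u => u.casesOn γ fun x u => if hx : x < a then f u ⟨x, hx⟩ else γ, fun U hU hUm => ?_⟩
    obtain ⟨x, U, rfl⟩ := List.exists_cons_of_length_eq_add_one hUm
    rw [hW'.map_fill_map_fill hV']
    rcases hU.cons_cases with ⟨hx, hU⟩ | ⟨rfl, hU⟩
    · rw [map_fill_self_cons_map_skip, initial_cons_of_lt hx]
      simpa [hx] using congrFun (hf U hU (by simpa using hUm)) ⟨x, hx⟩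
    · rw [initial_cons_self, map_fill_self_cons, map_fill_self_cons]
      have hV := hV.map_skip
      rw [Nat.add_right_comm] at hV
      rw [← Nat.add_assoc, Nat.add_right_comm] at hU
      exact hγ _ (hV.map_fill hU (by simpa using hUm)) (by simpa using hVM)

theorem grahamRothschild_zero (a m : ℕ) : GrahamRothschild a m 0 := by
  intro κ _
  obtain ⟨N, hN⟩ := exists_color_initial_eq_length a m κ
  refine ⟨N, fun c => ?_⟩
  obtain ⟨W, hWN, hW, f, hf⟩ := hN c
  refine ⟨W, hWN, hW, f m, fun U hU hUm => ?_⟩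
  rw [Nat.add_zero] at hU
  rw [← initial_eq_self (hW.map_fill hU hUm).lt, hf U a hU hUm, initial_eq_self hU.lt, hUm]

theorem grahamRothschild_succ.{u} {a d : ℕ} (h : ∀ m, GrahamRothschild.{u} (a + 1) m d) (m : ℕ) :
    GrahamRothschild.{u} a m (d + 1) := by
  intro κ _
  obtain ⟨M, hM⟩ := exists_color_initial_eq a m κ
  obtain ⟨N, hN⟩ := exists_color_eq_initial h M κ
  refine ⟨N, fun c => ?_⟩
  obtain ⟨W, hWN, hW, f, hf⟩ := hN c
  obtain ⟨V, hVM, hV, γ, hγ⟩ := hM f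
  refine ⟨W.map (fill a V), by simpa using hWN, hW.map_fill hV hVM, γ, fun U hU hUm => ?_⟩
  rw [hW.map_fill_map_fill hVM, hf _ (hV.map_fill hU hUm) (by simpa using hVM)]
  exact hγ U _ hU (by omega) hUm

theorem grahamRothschild (a m d : ℕ) : GrahamRothschild a m d := by
  induction d generalizing a m with
  | zero => exact grahamRothschild_zero a m
  | succ d ih => exact grahamRothschild_succ (ih (a + 1)) m

namespace ParamWord

variable {A : Type*} {P : Set A} {a k m n : ℕ} (e : P ≃ Fin a)

theorem ext_letter {X Y : ParamWord A k n} (h : ∀ p, X.letter p = Y.letter p) : X = Y := by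
  cases X
  cases Y
  congr
  exact funext h

/-- The symbol coded by a number below `a + k`, given a numbering of the alphabet `P`: the numbers
below `a` code the letters, `a + i` codes the parameter `λ_i`. -/
def decode (i : Fin (a + k)) : A ⊕ Fin k :=
  Fin.addCases (fun j => Sum.inl (e.symm j : A)) Sum.inr i

theorem decode_castAdd (j : Fin a) :
    decode e (Fin.castAdd k j) = Sum.inl (e.symm j : A) := by
  simp [decode]

theorem decode_natAdd (j : Fin k) : decode e (Fin.natAdd a j) = Sum.inr j := by
  simp [decode]

theorem decode_eq_inr_iff {i : Fin (a + k)} {j : Fin k} :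
    decode e i = Sum.inr j ↔ (i : ℕ) = a + j := by
  cases i using Fin.addCases with
  | left i => simpa [decode_castAdd] using by omega
  | right i => simp [decode_natAdd, Fin.ext_iff]

theorem mem_of_decode_eq_inl {i : Fin (a + k)} {x : A} (h : decode e i = Sum.inl x) : x ∈ P := by
  cases i using Fin.addCases with
  | left i =>
    rw [decode_castAdd] at h
    exact Sum.inl.inj h ▸ (e.symm i).2
  | right i => simp [decode_natAdd] at h

theorem exists_decode_eq {s : A ⊕ Fin k} (h : ∀ x, s = Sum.inl x → x ∈ P) :
    ∃ i, decode e i = s := by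
  rcases s with x | j
  · exact ⟨Fin.castAdd k (e ⟨x, h x rfl⟩), by simp [decode_castAdd]⟩
  · exact ⟨Fin.natAdd a j, decode_natAdd e j⟩

/-- The parameter word in the alphabet `P` coded by a growth word. -/
def ofGrowth {w : List ℕ} (hw : Growth a (a + k) w) (hn : w.length = n) : ParamWord A k n where
  letter p := decode e ⟨w[p], hw.lt _ (List.getElem_mem _)⟩
  occurs j := by
    obtain ⟨p, hp, hpj⟩ := List.getElem_of_mem (hw.mem (i := a + j) (by omega) (by omega))
    exact ⟨⟨p, hn ▸ hp⟩, (decode_eq_inr_iff e).2 hpj⟩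
  ordered i j hij q hq := by
    have hq := (decode_eq_inr_iff e).1 hq
    obtain ⟨p, hp, hpi⟩ := hw.exists_lt_getElem?_eq (i := a + i) (q := q) (by omega)
      (List.getElem?_eq_some_iff.2 ⟨by omega, by simpa [← hij, Nat.add_assoc] using hq⟩)
    exact ⟨⟨p, hp.trans q.is_lt⟩, hp,
      (decode_eq_inr_iff e).2 (List.getElem?_eq_some_iff.1 hpi).2⟩

variable {e}

theorem inAlphabet_ofGrowth {w : List ℕ} (hw : Growth a (a + k) w) (hn : w.length = n) :
    (ofGrowth e hw hn).InAlphabet P :=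
  fun _ _ h => mem_of_decode_eq_inl e h

variable (e) in
theorem exists_ofGrowth_eq {U : ParamWord A k n} (hU : U.InAlphabet P) :
    ∃ (u : List ℕ) (hu : Growth a (a + k) u) (hn : u.length = n), ofGrowth e hu hn = U := by
  choose f hf using fun p => exists_decode_eq e (hU p)
  have hfi {p : Fin n} {j : Fin k} : U.letter p = Sum.inr j ↔ (f p : ℕ) = a + j := by
    rw [← hf, decode_eq_inr_iff]
  refine ⟨List.ofFn fun p => (f p : ℕ), .of_forall (by omega) ?_ ?_ ?_, by simp,
    ext_letter fun p => by simp [ofGrowth, hf]⟩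
  · simp
  · intro i hai hib
    obtain ⟨p, hp⟩ := U.occurs ⟨i - a, by omega⟩
    have := hfi.1 hp
    exact List.mem_ofFn.2 ⟨p, by grind⟩
  · intro i q hai hq
    obtain ⟨hqn, hqi⟩ := List.getElem?_eq_some_iff.1 hq
    rw [List.getElem_ofFn] at hqi
    obtain ⟨p, hpq, hp⟩ := U.ordered ⟨i - a, by grind⟩ ⟨i - a + 1, by grind⟩ rfl _
      (hfi.2 (hqi.trans (by grind)))
    exact ⟨p, hpq, by grind⟩

theorem subst_ofGrowth {w u : List ℕ} (hw : Growth a (a + m) w) (hn : w.length = n)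
    (hu : Growth a (a + k) u) (hm : u.length = m) :
    (ofGrowth e hw hn).subst (ofGrowth e hu hm) =
      ofGrowth e (hw.map_fill hu hm) (by simpa using hn) := by
  have decode_fill (i : Fin (a + m)) (hi : fill a u i < a + k) :
      Sum.elim Sum.inl (ofGrowth e hu hm).letter (decode e i) = decode e ⟨fill a u i, hi⟩ := by
    cases i using Fin.addCases with
    | left i =>
      simp only [decode_castAdd, Sum.elim_inl, Fin.val_castAdd, fill_of_lt u i.is_lt]
      exact (decode_castAdd e i).symm
    | right i => simp [decode_natAdd, fill_add, ofGrowth, hm]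
  refine ext_letter fun p => (decode_fill _ ?_).trans (by simp [ofGrowth])
  exact (hw.map_fill hu hm).lt _ (List.mem_map_of_mem (List.getElem_mem _))

end ParamWord

theorem mainTheorem10_general {A κ : Type*} [Finite κ] [Nonempty κ] (P : Set A) [Finite P]
    (k m : ℕ) (hm : 0 < m) :
    ∃ N : ℕ, 0 < N ∧ ∀ χ : ParamWord A k N → κ,
      ∃ W : ParamWord A m N, W.InAlphabet P ∧
        ∃ c : κ, ∀ U : ParamWord A k m, U.InAlphabet P → χ (W.subst U) = c := by
  classical
  let e : P ≃ Fin (Nat.card P) := Finite.equivFin P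
  obtain ⟨N, hN⟩ := grahamRothschild (Nat.card P) m k κ
  have hNpos : 0 < N := by
    obtain ⟨w, hwN, hw, -⟩ := hN fun _ => Classical.arbitrary κ
    exact hwN ▸ List.length_pos_of_mem (hw.mem (i := Nat.card P) le_rfl (by omega))
  refine ⟨N, hNpos, fun χ => ?_⟩
  obtain ⟨w, hwN, hw, γ, hγ⟩ := hN fun v =>
    if h : Growth (Nat.card P) (Nat.card P + k) v ∧ v.length = N then
      χ (ParamWord.ofGrowth e h.1 h.2) else Classical.arbitrary κ
  refine ⟨ParamWord.ofGrowth e hw hwN, ParamWord.inAlphabet_ofGrowth hw hwN, γ, fun U hU => ?_⟩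
  obtain ⟨u, hu, hum, rfl⟩ := ParamWord.exists_ofGrowth_eq e hU
  rw [ParamWord.subst_ofGrowth, ← hγ u hu hum, dif_pos ⟨hw.map_fill hu hum, by simpa using hwN⟩]

theorem mainTheorem10 {A : Type*} [Finite A] (P : Set A) (k r m : ℕ)
    (hk : 0 < k) (hkm : k < m) (hr : 0 < r) :
    ∃ N : ℕ, 0 < N ∧ ∀ χ : ParamWord A k N → Fin r,
      ∃ W : ParamWord A m N, W.InAlphabet P ∧
        ∃ c : Fin r, ∀ U : ParamWord A k m, U.InAlphabet P → χ (W.subst U) = c :=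
  have : Nonempty (Fin r) := ⟨⟨0, hr⟩⟩
  mainTheorem10_general P k m (hk.trans hkm)
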